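/- Let $(X_n)_{n\ge 1}$ be a sequence of independent identically distributed, positive, square integrable real random variables with $\mathbb{E}X_1=\mu>0$ and $\operatorname{Var}X_1=\sigma^2$, where $\sigma>0$, and let $\gamma=\sigma/\mu$ be the coefficient of variation. For $n\ge 1$ and $1\le k\le n$ put $S_{n,k}=\sum_{i=1}^n X_i-X_k$. Then, almost surely, for every real $x$, $$\lim_{N\to\infty}\frac{1}{\log N}\sum_{n=1}^N\frac1n\, I\!\left(\left(\frac{\prod_{k=1}^n S_{n,k}}{(n-1)^n\mu^n}\right)^{1/(\gamma\sqrt n)}\le x\right)=F(x),$$ where $I$ denotes the indicator function and $F$ is the distribution function of $e^{\Phi}$ with $\Phi$ a standard normal random variable. (The quotient $0/0$ in the term $n=1$ is read as $0$; this single term does not affect the limit.) -/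

import Mathlib

open MeasureTheory ProbabilityTheory Filter Topology

noncomputable section

/-- The leave-one-out sum of the first `n` variables with the `k`-th one omitted. The sequence is
indexed from `0`, so `X i` is the variable usually written with index `i + 1`, and `k` ranges
over `0, …, n - 1`. -/
def leaveOneOutSum {Ω : Type*} (X : ℕ → Ω → ℝ) (n k : ℕ) (ω : Ω) : ℝ :=
  (∑ i ∈ Finset.range n, X i ω) - X k ω

/-- The normalized product of the leave-one-out sums,
`(∏ₖ S n k / ((n - 1) ^ n * μ ^ n)) ^ (1 / (γ * √n))`. -/
def normalizedProduct {Ω : Type*} (X : ℕ → Ω → ℝ) (μ γ : ℝ) (n : ℕ) (ω : Ω) : ℝ :=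
  ((∏ k ∈ Finset.range n, leaveOneOutSum X n k ω) / (((n : ℝ) - 1) ^ n * μ ^ n)) ^
    (1 / (γ * Real.sqrt (n : ℝ)))

/-- The distribution function of `exp Φ`, where `Φ` is a standard normal random variable. -/
def cdfExpNormal (x : ℝ) : ℝ :=
  cdf ((gaussianReal 0 1).map Real.exp) x

end

/-! Put `Z i = (X i - μ) / σ`. The logarithm of the normalized product is `1 / (γ √n)` times the sum
of the `log` of the quotients `S n k / ((n - 1) μ)`. Each variable is missing from exactly one of
the `n` sums, so replacing `log t` by `t - 1` turns this into exactly `n ^ (-1/2) ∑ Z i`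
(`normalizedSum_eq_sum_leaveOneOutSum`). By the strong law all quotients are eventually at least `1
/ 2`, so the error is quadratic. The squares add up to a quantity of bounded expectation, hence
after division by `√n` and weighting by `1 / n` the errors are almost surely summable and invisible
to Lipschitz test functions (`tendsto_logAverage_ramp_logNormalizedProduct`).

What remains is the almost sure central limit theorem for `normalizedSum`
(`ae_tendsto_logAverage_comp_normalizedSum`). Covariances of order `√(k / l)` make the variance of
the logarithmic average `O(1 / log N)`, which is summable along `2 ^ (j ^ 2)`; monotonicity fills
the gaps, and the means converge by the classical theorem. Countably many ramp functions then
determine the limit for all indicators at once, because the Gaussian distribution function is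
continuous. -/

/-! ### Logarithmic averages -/

/-- The logarithmic average of the terms `u 1, …, u N`. -/
noncomputable def logAverage (u : ℕ → ℝ) (N : ℕ) : ℝ :=
  (1 / Real.log (N : ℝ)) * ∑ n ∈ Finset.Icc 1 N, (1 / (n : ℝ)) * u n

theorem tendsto_log_natCast_atTop : Tendsto (fun N : ℕ => Real.log (N : ℝ)) atTop atTop :=
  Real.tendsto_log_atTop.comp tendsto_natCast_atTop_atTop

theorem sum_Icc_one_eq_sum_range (u : ℕ → ℝ) (N : ℕ) :
    ∑ n ∈ Finset.Icc 1 N, u n = ∑ n ∈ Finset.range N, u (n + 1) := by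
  induction N with
  | zero => simp
  | succ N ih => rw [Finset.sum_Icc_succ_top (by omega), ih, Finset.sum_range_succ]

theorem sum_Icc_one_div_eq_harmonic (N : ℕ) :
    ∑ n ∈ Finset.Icc 1 N, 1 / (n : ℝ) = (harmonic N : ℝ) := by
  rw [harmonic_eq_sum_Icc]
  push_cast
  simp

theorem sum_Icc_one_div_le (N : ℕ) :
    ∑ n ∈ Finset.Icc 1 N, 1 / (n : ℝ) ≤ 1 + Real.log N := by
  rw [sum_Icc_one_div_eq_harmonic]
  exact harmonic_le_one_add_log N

theorem log_le_sum_Icc_one_div (N : ℕ) :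
    Real.log N ≤ ∑ n ∈ Finset.Icc 1 N, 1 / (n : ℝ) := by
  rw [sum_Icc_one_div_eq_harmonic]
  refine le_trans ?_ (log_add_one_le_harmonic N)
  rcases Nat.eq_zero_or_pos N with rfl | h
  · simp
  · exact Real.log_le_log (by positivity) (by norm_num)

theorem logAverage_mono {u v : ℕ → ℝ} (h : ∀ n, u n ≤ v n) (N : ℕ) :
    logAverage u N ≤ logAverage v N := by
  unfold logAverage
  have := Real.log_natCast_nonneg N
  gcongr with n _
  exact h n

theorem logAverage_sub (u v : ℕ → ℝ) (N : ℕ) :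
    logAverage (fun n => u n - v n) N = logAverage u N - logAverage v N := by
  simp only [logAverage, mul_sub, Finset.sum_sub_distrib]

theorem tendsto_logAverage_one : Tendsto (logAverage fun _ => 1) atTop (𝓝 1) := by
  have h : Tendsto (fun N : ℕ => 1 / Real.log (N : ℝ) + 1) atTop (𝓝 (0 + 1)) :=
    (tendsto_const_nhds.div_atTop tendsto_log_natCast_atTop).add_const 1
  rw [zero_add] at h
  refine tendsto_of_tendsto_of_tendsto_of_le_of_le' tendsto_const_nhds h ?_ ?_
  all_goals
    filter_upwards [tendsto_log_natCast_atTop.eventually_gt_atTop 0] with N hN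
    simp only [logAverage, mul_one]
    rw [one_div_mul_eq_div]
  · rw [le_div_iff₀ hN, one_mul]
    exact log_le_sum_Icc_one_div N
  · rw [div_add_one hN.ne']
    gcongr
    exact sum_Icc_one_div_le N

theorem tendsto_logAverage_zero_of_tendsto {u : ℕ → ℝ} (h : Tendsto u atTop (𝓝 0)) :
    Tendsto (logAverage u) atTop (𝓝 0) := by
  have hf : (fun n : ℕ => (1 / ((n + 1 : ℕ) : ℝ)) * u (n + 1)) =o[atTop]
      (fun n : ℕ => 1 / ((n + 1 : ℕ) : ℝ)) := by
    have := (Asymptotics.isBigO_refl (fun n : ℕ => 1 / ((n + 1 : ℕ) : ℝ)) atTop).mul_isLittleO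
      ((Asymptotics.isLittleO_one_iff ℝ).2 ((tendsto_add_atTop_iff_nat 1).2 h))
    simpa using this
  have hs := hf.sum_range (fun n => by positivity) (by
    simp_rw [← sum_Icc_one_eq_sum_range (fun n => 1 / (n : ℝ))]
    exact tendsto_atTop_mono log_le_sum_Icc_one_div tendsto_log_natCast_atTop)
  simp_rw [← sum_Icc_one_eq_sum_range (fun n => 1 / (n : ℝ)),
    ← sum_Icc_one_eq_sum_range (fun n => 1 / (n : ℝ) * u n)] at hs
  have hmul := hs.tendsto_div_nhds_zero.mul tendsto_logAverage_one
  rw [zero_mul] at hmul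
  refine hmul.congr' ?_
  filter_upwards [tendsto_log_natCast_atTop.eventually_gt_atTop 0] with N hN
  have : 0 < ∑ n ∈ Finset.Icc 1 N, 1 / (n : ℝ) := hN.trans_le (log_le_sum_Icc_one_div N)
  simp only [logAverage, mul_one]
  field_simp

theorem tendsto_logAverage_of_tendsto {u : ℕ → ℝ} {l : ℝ} (h : Tendsto u atTop (𝓝 l)) :
    Tendsto (logAverage u) atTop (𝓝 l) := by
  have h0 : Tendsto (fun n => u n - l) atTop (𝓝 0) := by simpa using h.sub_const l
  have := (tendsto_logAverage_zero_of_tendsto h0).add (tendsto_logAverage_one.const_mul l)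
  simp only [zero_add, mul_one] at this
  refine this.congr fun N => ?_
  rw [logAverage_sub, logAverage, logAverage, logAverage]
  simp only [mul_one, ← Finset.sum_mul]
  ring

/-- The weighted partial sums stay bounded while `log N` diverges. This disposes of the
linearization error without showing that it tends to zero. -/
theorem tendsto_logAverage_zero_of_summable {u : ℕ → ℝ}
    (h : Summable fun n : ℕ => (1 / (n : ℝ)) * |u n|) :
    Tendsto (logAverage u) atTop (𝓝 0) := by
  have hb : Tendsto (fun N : ℕ => (1 / Real.log (N : ℝ)) * ∑' n : ℕ, (1 / (n : ℝ)) * |u n|)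
      atTop (𝓝 0) := by
    have : Tendsto (fun N : ℕ => 1 / Real.log (N : ℝ)) atTop (𝓝 0) :=
      tendsto_const_nhds.div_atTop tendsto_log_natCast_atTop
    simpa using this.mul_const (∑' n : ℕ, (1 / (n : ℝ)) * |u n|)
  refine squeeze_zero_norm (fun N => ?_) hb
  have hl := Real.log_natCast_nonneg N
  rw [logAverage, norm_mul, Real.norm_of_nonneg (by positivity)]
  gcongr
  refine (norm_sum_le _ _).trans ?_
  refine le_trans (Finset.sum_le_sum fun n _ => le_of_eq ?_)
    (h.sum_le_tsum (Finset.Icc 1 N) fun n _ => by positivity)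
  rw [norm_mul, Real.norm_of_nonneg (by positivity), Real.norm_eq_abs]

theorem tendsto_logAverage_congr {u v : ℕ → ℝ} {l : ℝ} (h : u =ᶠ[atTop] v)
    (hu : Tendsto (logAverage u) atTop (𝓝 l)) : Tendsto (logAverage v) atTop (𝓝 l) := by
  have h0 : Tendsto (fun n => v n - u n) atTop (𝓝 0) := by
    refine tendsto_const_nhds.congr' ?_
    filter_upwards [h] with n hn
    rw [hn, sub_self]
  have := (tendsto_logAverage_zero_of_tendsto h0).add hu
  simp only [zero_add] at this
  exact this.congr fun N => by rw [logAverage_sub]; ring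

theorem log_two_pow_sq (j : ℕ) :
    Real.log ((2 ^ (j ^ 2) : ℕ) : ℝ) = (j : ℝ) ^ 2 * Real.log 2 := by
  push_cast
  rw [Real.log_pow]
  push_cast
  rfl

/-- Convergence of logarithmic averages of nonnegative terms can be tested along the
subsequence `2 ^ (j ^ 2)`. -/
theorem tendsto_logAverage_of_tendsto_subseq {u : ℕ → ℝ} (h0 : ∀ n, 0 ≤ u n)
    {l : ℝ}
    (h : Tendsto (fun j : ℕ => logAverage u (2 ^ (j ^ 2))) atTop (𝓝 l)) :
    Tendsto (logAverage u) atTop (𝓝 l) := by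
  set D : ℕ → ℝ := fun N => ∑ n ∈ Finset.Icc 1 N, (1 / (n : ℝ)) * u n with hD
  have hDmono : Monotone D := fun a b hab =>
    Finset.sum_le_sum_of_subset_of_nonneg (Finset.Icc_subset_Icc_right hab)
      fun n _ _ => mul_nonneg (by positivity) (h0 n)
  have hD0 : ∀ N, 0 ≤ D N := fun N => Finset.sum_nonneg fun n _ => mul_nonneg (by positivity) (h0 n)
  have hlog2 : 0 < Real.log 2 := Real.log_pos (by norm_num)
  -- the index `j` with `2 ^ (j ^ 2) ≤ N < 2 ^ ((j + 1) ^ 2)`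
  set j : ℕ → ℕ := fun N => Nat.sqrt (Nat.log 2 N) with hj
  have hjtop : Tendsto j atTop atTop := by
    refine tendsto_atTop.2 fun b => ?_
    filter_upwards [eventually_ge_atTop (2 ^ (b ^ 2))] with N hN
    refine Nat.le_sqrt'.2 ?_
    exact Nat.le_log_of_pow_le (by norm_num) hN
  have hlow : ∀ N, N ≠ 0 → 2 ^ (j N ^ 2) ≤ N := fun N hN =>
    (Nat.pow_le_pow_right (by norm_num) (Nat.sqrt_le' _)).trans (Nat.pow_log_le_self 2 hN)
  have hup : ∀ N, N ≤ 2 ^ ((j N + 1) ^ 2) := fun N =>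
    (Nat.lt_pow_succ_log_self (by norm_num) N).le.trans
      (Nat.pow_le_pow_right (by norm_num) (Nat.lt_succ_sqrt' _))
  -- The logarithms of consecutive points of the subsequence have ratio tending to `1`, so the
  -- sandwich loses nothing in the limit.
  have hratio : Tendsto (fun i : ℕ => ((i : ℝ) / ((i : ℝ) + 1)) ^ 2) atTop (𝓝 1) := by
    simpa using (tendsto_natCast_div_add_atTop (1 : ℝ)).pow 2
  have hL : Tendsto (fun N => logAverage u (2 ^ (j N ^ 2)) * ((j N : ℝ) / ((j N : ℝ) + 1)) ^ 2)
      atTop (𝓝 l) := by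
    simpa [Function.comp_def] using (h.mul hratio).comp hjtop
  have hU : Tendsto (fun N => logAverage u (2 ^ ((j N + 1) ^ 2)) /
      ((j N : ℝ) / ((j N : ℝ) + 1)) ^ 2) atTop (𝓝 l) := by
    simpa [Function.comp_def, Pi.div_def] using
      (((tendsto_add_atTop_iff_nat 1).2 h).div hratio one_ne_zero).comp hjtop
  refine tendsto_of_tendsto_of_tendsto_of_le_of_le' hL hU ?_ ?_
  all_goals
    filter_upwards [hjtop.eventually_ge_atTop 1, eventually_ge_atTop 2] with N hjN hN
    have hj0 : (0 : ℝ) < j N := by exact_mod_cast hjN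
    have hN0 : (0 : ℝ) < N := by positivity
    have hlogN : 0 < Real.log N := Real.log_pos (by exact_mod_cast hN)
    rw [logAverage, logAverage, log_two_pow_sq]
  · have h1 : Real.log N ≤ ((j N + 1 : ℕ) : ℝ) ^ 2 * Real.log 2 := by
      rw [← log_two_pow_sq]
      exact Real.log_le_log hN0 (by exact_mod_cast hup N)
    push_cast at h1
    calc _ = D (2 ^ (j N ^ 2)) / (((j N : ℝ) + 1) ^ 2 * Real.log 2) := by
          simp only [hD]
          field_simp
      _ ≤ D N / Real.log N := by
          gcongr
          · exact hD0 _
          · exact hDmono (hlow N (by omega))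
      _ = _ := by simp only [hD]; ring
  · have h1 : (j N : ℝ) ^ 2 * Real.log 2 ≤ Real.log N := by
      rw [← log_two_pow_sq]
      exact Real.log_le_log (by positivity) (by exact_mod_cast hlow N (by omega))
    calc _ = D N / Real.log N := by simp only [hD]; ring
      _ ≤ D (2 ^ ((j N + 1) ^ 2)) / ((j N : ℝ) ^ 2 * Real.log 2) := by
          gcongr
          · exact hD0 _
          · exact hDmono (hup N)
      _ = _ := by
          simp only [hD]
          push_cast
          field_simp

/-! ### Ramp functions and the passage to indicators -/

/-- The continuous function equal to `1` up to `q - 1 / m`, to `0` from `q` on, and affine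
in between. -/
def ramp (q m t : ℝ) : ℝ := max 0 (min 1 (m * (q - t)))

theorem ramp_nonneg (q m t : ℝ) : 0 ≤ ramp q m t := le_max_left _ _

theorem ramp_le_one (q m t : ℝ) : ramp q m t ≤ 1 := max_le zero_le_one (min_le_left _ _)

theorem ramp_eq_zero {q m t : ℝ} (hm : 0 ≤ m) (h : q ≤ t) : ramp q m t = 0 :=
  max_eq_left ((min_le_right _ _).trans (mul_nonpos_of_nonneg_of_nonpos hm (by linarith)))

theorem ramp_eq_one {q m t : ℝ} (hm : 0 < m) (h : t ≤ q - 1 / m) : ramp q m t = 1 := by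
  have : 1 ≤ m * (q - t) := by
    rw [← div_le_iff₀' hm]
    linarith
  rw [ramp, min_eq_left this, max_eq_right zero_le_one]

theorem abs_ramp_sub_le {q m : ℝ} (hm : 0 ≤ m) (s t : ℝ) :
    |ramp q m s - ramp q m t| ≤ m * |s - t| := by
  have h1 := abs_max_sub_max_le_max 0 (min 1 (m * (q - s))) 0 (min 1 (m * (q - t)))
  have h2 := abs_min_sub_min_le_max 1 (m * (q - s)) 1 (m * (q - t))
  simp only [sub_self, abs_zero, abs_nonneg, max_eq_right] at h1 h2
  refine h1.trans (h2.trans (le_of_eq ?_))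
  rw [← mul_sub, abs_mul, abs_of_nonneg hm, show q - s - (q - t) = t - s by ring, abs_sub_comm]

theorem continuous_ramp (q m : ℝ) : Continuous (ramp q m) := by
  unfold ramp
  fun_prop

theorem integrable_ramp (q m : ℝ) (ν : Measure ℝ) [IsFiniteMeasure ν] :
    Integrable (ramp q m) ν :=
  .of_bound (continuous_ramp q m).aestronglyMeasurable 1 (.of_forall fun t => by
    rw [Real.norm_of_nonneg (ramp_nonneg q m t)]; exact ramp_le_one q m t)

theorem integral_ramp_le {q m : ℝ} (hm : 0 ≤ m) (ν : Measure ℝ) [IsFiniteMeasure ν] :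
    ∫ t, ramp q m t ∂ν ≤ ν.real (Set.Iic q) := by
  rw [← integral_indicator_one measurableSet_Iic]
  refine integral_mono (integrable_ramp q m ν) ((integrable_const 1).indicator measurableSet_Iic)
    fun t => ?_
  by_cases h : t ≤ q
  · simpa [h] using ramp_le_one q m t
  · simp [h, ramp_eq_zero hm (not_le.1 h).le]

theorem le_integral_ramp {q m : ℝ} (hm : 0 < m) (ν : Measure ℝ) [IsFiniteMeasure ν] :
    ν.real (Set.Iic (q - 1 / m)) ≤ ∫ t, ramp q m t ∂ν := by
  rw [← integral_indicator_one measurableSet_Iic]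
  refine integral_mono ((integrable_const 1).indicator measurableSet_Iic) (integrable_ramp q m ν)
    fun t => ?_
  by_cases h : t ≤ q - 1 / m
  · simp only [Set.indicator_apply, Set.mem_Iic, h, if_true, Pi.one_apply, ramp_eq_one hm h, le_refl]
  · simpa only [Set.indicator_apply, Set.mem_Iic, h, if_false] using ramp_nonneg q m t

/-- The jump of the distribution function at a point is the mass of that point. -/
theorem continuous_cdf (ν : Measure ℝ) [IsProbabilityMeasure ν] [NullSingletonClass ν] :
    Continuous (fun x => ν.real (Set.Iic x)) := by
  have h : (fun x => ν.real (Set.Iic x)) = cdf ν := funext fun x => (cdf_eq_real ν x).symm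
  rw [h, continuous_iff_continuousAt]
  intro x
  rw [(monotone_cdf ν).continuousAt_iff_leftLim_eq_rightLim, StieltjesFunction.rightLim_eq]
  have h1 := (cdf ν).measure_singleton x
  rw [measure_cdf, measure_singleton] at h1
  have h2 := (monotone_cdf ν).leftLim_le (le_refl x)
  have := ENNReal.ofReal_eq_zero.1 h1.symm
  linarith

theorem cdfExpNormal_of_nonpos {x : ℝ} (hx : x ≤ 0) : cdfExpNormal x = 0 := by
  have : IsProbabilityMeasure ((gaussianReal 0 1).map Real.exp) :=
    Measure.isProbabilityMeasure_map Real.measurable_exp.aemeasurable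
  rw [cdfExpNormal, cdf_eq_real, map_measureReal_apply Real.measurable_exp measurableSet_Iic]
  convert measureReal_empty
  ext t
  simpa using hx.trans_lt (Real.exp_pos t)

theorem cdfExpNormal_of_pos {x : ℝ} (hx : 0 < x) :
    cdfExpNormal x = (gaussianReal 0 1).real (Set.Iic (Real.log x)) := by
  have : IsProbabilityMeasure ((gaussianReal 0 1).map Real.exp) :=
    Measure.isProbabilityMeasure_map Real.measurable_exp.aemeasurable
  rw [cdfExpNormal, cdf_eq_real, map_measureReal_apply Real.measurable_exp measurableSet_Iic]
  congr 1
  ext t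
  simp [Real.le_log_iff_exp_le hx]

theorem tendsto_logAverage_indicator {ν : Measure ℝ} [IsProbabilityMeasure ν] [NullSingletonClass ν]
    {Y : ℕ → ℝ}
    (h : ∀ (q : ℚ) (m : ℕ),
      Tendsto (logAverage fun n => ramp q m (Y n)) atTop (𝓝 (∫ t, ramp q m t ∂ν))) (y : ℝ) :
    Tendsto (logAverage fun n => (Set.Iic y).indicator (fun _ => (1 : ℝ)) (Y n)) atTop
      (𝓝 (ν.real (Set.Iic y))) := by
  have hcont := (continuous_cdf ν).tendsto y
  refine tendsto_order.2 ⟨fun a ha => ?_, fun a ha => ?_⟩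
  all_goals
    obtain ⟨δ, hδ, hball⟩ := Metric.eventually_nhds_iff.1 (hcont.eventually (by
      first | exact lt_mem_nhds ha | exact gt_mem_nhds ha))
    obtain ⟨m, hm⟩ := exists_nat_one_div_lt (half_pos hδ)
    have hm0 : (0 : ℝ) < ((m + 1 : ℕ) : ℝ) := by positivity
    have hm' : 1 / ((m + 1 : ℕ) : ℝ) < δ / 2 := by exact_mod_cast hm
    have hm1 : 0 < 1 / ((m + 1 : ℕ) : ℝ) := by positivity
  -- This ramp lies below the indicator and is `1` up to a point within `δ` of `y`.
  · obtain ⟨q, hq1, hq2⟩ := exists_rat_btwn (show y - δ / 2 < y by linarith)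
    have h1 : a < ∫ t, ramp q (m + 1 : ℕ) t ∂ν := lt_of_lt_of_le
      (hball (by rw [Real.dist_eq, abs_lt]; constructor <;> linarith)) (le_integral_ramp hm0 ν)
    filter_upwards [(h q (m + 1)).eventually (lt_mem_nhds h1)] with N hN
    refine hN.trans_le (logAverage_mono (fun n => ?_) N)
    by_cases hy : Y n ≤ y
    · simpa [hy] using ramp_le_one _ _ _
    · rw [ramp_eq_zero hm0.le (hq2.le.trans (not_le.1 hy).le)]
      simp [hy]
  -- This ramp is still `1` at `y`, so it lies above the indicator, and it vanishes from `q < y + δ`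
  -- on.
  · obtain ⟨q, hq1, hq2⟩ := exists_rat_btwn (show y + δ / 2 < y + δ by linarith)
    have h1 : ∫ t, ramp q (m + 1 : ℕ) t ∂ν < a := lt_of_le_of_lt (integral_ramp_le hm0.le ν)
      (hball (by rw [Real.dist_eq, abs_lt]; constructor <;> linarith))
    filter_upwards [(h q (m + 1)).eventually (gt_mem_nhds h1)] with N hN
    refine (logAverage_mono (fun n => ?_) N).trans_lt hN
    by_cases hy : Y n ≤ y
    · rw [ramp_eq_one hm0 (by linarith)]
      simp [hy]
    · simpa [hy] using ramp_nonneg _ _ _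

theorem tendsto_logAverage_indicator_exp {Y V : ℕ → ℝ}
    (hV : ∀ᶠ n in atTop, V n = Real.exp (Y n))
    (h : ∀ (q : ℚ) (m : ℕ), Tendsto (logAverage fun n => ramp q m (Y n)) atTop
      (𝓝 (∫ t, ramp q m t ∂(gaussianReal 0 1)))) (x : ℝ) :
    Tendsto (logAverage fun n => (Set.Iic x).indicator (fun _ => (1 : ℝ)) (V n)) atTop
      (𝓝 (cdfExpNormal x)) := by
  rcases le_or_gt x 0 with hx | hx
  · rw [cdfExpNormal_of_nonpos hx]
    refine tendsto_logAverage_zero_of_tendsto (tendsto_const_nhds.congr' ?_)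
    filter_upwards [hV] with n hn
    rw [hn, Set.indicator_of_notMem]
    simpa using hx.trans_lt (Real.exp_pos _)
  · rw [cdfExpNormal_of_pos hx]
    have : NullSingletonClass (gaussianReal 0 1) := nullSingletonClass_gaussianReal one_ne_zero
    refine tendsto_logAverage_congr ?_ (tendsto_logAverage_indicator h (Real.log x))
    filter_upwards [hV] with n hn
    simp only [hn, Set.indicator_apply, Set.mem_Iic, Real.le_log_iff_exp_le hx]

/-! ### The almost sure central limit theorem -/

section

variable {Ω : Type*} [MeasurableSpace Ω] {P : Measure Ω}

/-- By Tonelli the sum has finite expectation, so it is finite almost everywhere. -/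
theorem ae_summable_of_summable_integral {Y : ℕ → Ω → ℝ} (hint : ∀ n, Integrable (Y n) P)
    (h0 : ∀ n ω, 0 ≤ Y n ω) (hsum : Summable fun n => ∫ ω, Y n ω ∂P) :
    ∀ᵐ ω ∂P, Summable fun n => Y n ω := by
  have hm : ∀ n, AEMeasurable (fun ω => ENNReal.ofReal (Y n ω)) P := fun n =>
    (hint n).aemeasurable.ennreal_ofReal
  have hfin : ∫⁻ ω, ∑' n, ENNReal.ofReal (Y n ω) ∂P ≠ ⊤ := by
    rw [lintegral_tsum hm]
    simp_rw [← fun n => ofReal_integral_eq_lintegral_ofReal (hint n) (.of_forall (h0 n))]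
    exact hsum.tsum_ofReal_ne_top
  filter_upwards [ae_lt_top' (AEMeasurable.tsum hm) hfin] with ω hω
  have := ENNReal.summable_toReal hω.ne
  simpa only [ENNReal.toReal_ofReal (h0 _ ω)] using this

theorem integral_abs_le_sqrt_integral_sq [IsProbabilityMeasure P] {Y : Ω → ℝ} (hY : MemLp Y 2 P) :
    ∫ ω, |Y ω| ∂P ≤ √(∫ ω, Y ω ^ 2 ∂P) := by
  refine Real.le_sqrt_of_sq_le ?_
  have h := variance_eq_sub hY.abs
  have h0 := variance_nonneg |Y| P
  simp only [Pi.pow_apply, Pi.abs_apply, sq_abs] at h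
  linarith

theorem integral_sq_sum_of_iIndepFun [IsProbabilityMeasure P] {Z : ℕ → Ω → ℝ}
    (hindep : iIndepFun Z P) (hident : ∀ i, IdentDistrib (Z i) (Z 0) P P)
    (hsq : MemLp (Z 0) 2 P) (hmean : ∫ ω, Z 0 ω ∂P = 0) (s : Finset ℕ) :
    ∫ ω, (∑ i ∈ s, Z i ω) ^ 2 ∂P = s.card * ∫ ω, Z 0 ω ^ 2 ∂P := by
  have hm : ∀ i, MemLp (Z i) 2 P := fun i => (hident i).memLp_iff.2 hsq
  have hsum := IndepFun.variance_sum (s := s) (fun i _ => hm i)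
    (fun i _ j _ hij => hindep.indepFun hij)
  have hmeans : ∫ ω, (∑ i ∈ s, Z i) ω ∂P = 0 := by
    simp only [Finset.sum_apply]
    rw [integral_finsetSum _ fun i _ => (hm i).integrable (by norm_num)]
    exact Finset.sum_eq_zero fun i _ => by rw [(hident i).integral_eq, hmean]
  rw [variance_of_integral_eq_zero (memLp_finsetSum' s fun i _ => hm i).aemeasurable hmeans] at hsum
  simp only [Finset.sum_apply] at hsum
  rw [hsum, Finset.sum_congr rfl fun i _ => (hident i).variance_eq, Finset.sum_const,
    variance_of_integral_eq_zero hsq.aemeasurable hmean, nsmul_eq_mul]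

/-- The sum of the first `n` variables divided by the square root of `n`. -/
noncomputable def normalizedSum (Z : ℕ → Ω → ℝ) (n : ℕ) (ω : Ω) : ℝ :=
  (√n)⁻¹ * ∑ k ∈ Finset.range n, Z k ω

theorem aemeasurable_normalizedSum {Z : ℕ → Ω → ℝ} (hm : ∀ i, AEMeasurable (Z i) P) (n : ℕ) :
    AEMeasurable (normalizedSum Z n) P :=
  .const_mul (Finset.aemeasurable_fun_sum _ fun _ _ => hm _) _

/-- A continuous function with values in the unit interval that is `K`-Lipschitz. -/
structure IsUnitLipschitz (f : ℝ → ℝ) (K : ℝ) : Prop where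
  nonneg : ∀ t, 0 ≤ f t
  le_one : ∀ t, f t ≤ 1
  abs_sub_le : ∀ s t, |f s - f t| ≤ K * |s - t|
  continuous : Continuous f

namespace IsUnitLipschitz

variable {f : ℝ → ℝ} {K : ℝ}

theorem abs_le_one (hf : IsUnitLipschitz f K) (t : ℝ) : |f t| ≤ 1 := by
  rw [abs_of_nonneg (hf.nonneg t)]
  exact hf.le_one t

theorem lipschitz_const_nonneg (hf : IsUnitLipschitz f K) : 0 ≤ K := by
  have := (abs_nonneg _).trans (hf.abs_sub_le 1 0)
  simpa using this

theorem aestronglyMeasurable_comp (hf : IsUnitLipschitz f K) {Y : Ω → ℝ} (hY : AEMeasurable Y P) :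
    AEStronglyMeasurable (fun ω => f (Y ω)) P :=
  (hf.continuous.measurable.comp_aemeasurable hY).aestronglyMeasurable

theorem memLp_comp [IsProbabilityMeasure P] (hf : IsUnitLipschitz f K) {Y : Ω → ℝ}
    (hY : AEMeasurable Y P) : MemLp (fun ω => f (Y ω)) 2 P :=
  .of_bound (hf.aestronglyMeasurable_comp hY) 1 (.of_forall fun _ => hf.abs_le_one _)

theorem integrable_comp [IsProbabilityMeasure P] (hf : IsUnitLipschitz f K) {Y : Ω → ℝ}
    (hY : AEMeasurable Y P) : Integrable (fun ω => f (Y ω)) P :=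
  (hf.memLp_comp hY).integrable (by norm_num)

end IsUnitLipschitz

theorem abs_covariance_le_of_abs_le_one [IsProbabilityMeasure P] {g U : Ω → ℝ} (hg : MemLp g 2 P)
    (hg1 : ∀ ω, |g ω| ≤ 1) (hU : MemLp U 2 P) : |cov[g, U; P]| ≤ 2 * ∫ ω, |U ω| ∂P := by
  rw [covariance_eq_sub hg hU]
  have hUi : Integrable (fun ω => |U ω|) P := (hU.integrable (by norm_num)).abs
  have h1 : |∫ ω, (g * U) ω ∂P| ≤ ∫ ω, |U ω| ∂P := by
    refine abs_integral_le_integral_abs.trans (integral_mono_of_nonneg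
      (.of_forall fun ω => abs_nonneg _) hUi (.of_forall fun ω => ?_))
    simp only [Pi.mul_apply, abs_mul]
    exact mul_le_of_le_one_left (abs_nonneg _) (hg1 ω)
  have h2 : |∫ ω, g ω ∂P| ≤ 1 := by
    have := norm_integral_le_of_norm_le_const (μ := P) (f := g) (C := 1) (.of_forall hg1)
    simpa using this
  have h3 : |∫ ω, U ω ∂P| ≤ ∫ ω, |U ω| ∂P := abs_integral_le_integral_abs
  refine (abs_sub _ _).trans ?_
  rw [abs_mul, two_mul]
  exact add_le_add h1 ((mul_le_of_le_one_left (abs_nonneg _) h2).trans h3)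

variable [IsProbabilityMeasure P] {Z : ℕ → Ω → ℝ} {f : ℝ → ℝ} {K : ℝ}

/-- Removing the first `k` summands from the `l`-th normalized sum leaves `T`, which is independent
of the `k`-th one. Only the change in `f` contributes: it is at most `K / √l` times the absolute
value of the removed sum, whose mean is at most `√k`. -/
theorem abs_covariance_comp_normalizedSum_le (hindep : iIndepFun Z P)
    (hident : ∀ i, IdentDistrib (Z i) (Z 0) P P) (hsq : MemLp (Z 0) 2 P)
    (hmean : ∫ ω, Z 0 ω ∂P = 0) (hvar : ∫ ω, Z 0 ω ^ 2 ∂P = 1) (hf : IsUnitLipschitz f K)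
    {k l : ℕ} (hkl : k ≤ l) :
    |cov[fun ω => f (normalizedSum Z k ω), fun ω => f (normalizedSum Z l ω); P]| ≤
      2 * (K * (√k / √l)) := by
  have hm : ∀ i, MemLp (Z i) 2 P := fun i => (hident i).memLp_iff.2 hsq
  have hma : ∀ i, AEMeasurable (Z i) P := fun i => (hm i).aemeasurable
  set T : Ω → ℝ := fun ω => (√l)⁻¹ * ∑ i ∈ Finset.Ico k l, Z i ω with hT
  have hTm : AEMeasurable T P :=
    .const_mul (Finset.aemeasurable_fun_sum _ fun _ _ => hma _) _
  have hind : IndepFun (fun ω => f (normalizedSum Z k ω)) (fun ω => f (T ω)) P := by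
    have hd : Disjoint (Finset.range k) (Finset.Ico k l) := by
      rw [Finset.range_eq_Ico]
      exact Finset.Ico_disjoint_Ico_consecutive 0 k l
    have h := hindep.indepFun_finset₀ _ _ hd hma
    have h' := h.comp (φ := fun z : Finset.range k → ℝ => f ((√k)⁻¹ * ∑ i, z i))
      (ψ := fun z : Finset.Ico k l → ℝ => f ((√l)⁻¹ * ∑ i, z i))
      (hf.continuous.measurable.comp (by fun_prop))
      (hf.continuous.measurable.comp (by fun_prop))
    convert! h' using 1
    · ext ω
      simp only [Function.comp_apply, normalizedSum]
      rw [← Finset.sum_coe_sort (Finset.range k)]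
    · ext ω
      simp only [Function.comp_apply, hT]
      rw [← Finset.sum_coe_sort (Finset.Ico k l)]
  have hk := hf.memLp_comp (aemeasurable_normalizedSum hma k)
  have hl := hf.memLp_comp (aemeasurable_normalizedSum hma l)
  have hTL := hf.memLp_comp hTm
  have hcov : cov[fun ω => f (normalizedSum Z k ω), fun ω => f (normalizedSum Z l ω); P] =
      cov[fun ω => f (normalizedSum Z k ω),
        (fun ω => f (normalizedSum Z l ω)) - fun ω => f (T ω); P] := by
    rw [covariance_sub_right hk hl hTL, hind.covariance_eq_zero hk hTL, sub_zero]
  rw [hcov]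
  refine (abs_covariance_le_of_abs_le_one hk (fun ω => hf.abs_le_one _) (hl.sub hTL)).trans ?_
  gcongr
  have hS : MemLp (fun ω => ∑ i ∈ Finset.range k, Z i ω) 2 P := memLp_finsetSum _ fun i _ => hm i
  calc ∫ ω, |((fun ω => f (normalizedSum Z l ω)) - fun ω => f (T ω)) ω| ∂P
      ≤ ∫ ω, K * (√l)⁻¹ * |∑ i ∈ Finset.range k, Z i ω| ∂P := by
        refine integral_mono ((hl.sub hTL).integrable (by norm_num)).abs
          ((hS.integrable (by norm_num)).abs.const_mul _) fun ω => ?_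
        refine (hf.abs_sub_le _ _).trans (le_of_eq ?_)
        rw [normalizedSum, ← Finset.sum_range_add_sum_Ico _ hkl, mul_add, hT]
        simp only [add_sub_cancel_right]
        rw [abs_mul, abs_of_nonneg (by positivity : 0 ≤ (√l : ℝ)⁻¹), mul_assoc]
    _ = K * (√l)⁻¹ * ∫ ω, |∑ i ∈ Finset.range k, Z i ω| ∂P := integral_const_mul _ _
    _ ≤ K * (√l)⁻¹ * √k := by
        have := hf.lipschitz_const_nonneg
        gcongr
        refine (integral_abs_le_sqrt_integral_sq hS).trans (le_of_eq ?_)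
        rw [integral_sq_sum_of_iIndepFun hindep hident hsq hmean, hvar, Finset.card_range, mul_one]
    _ = K * (√k / √l) := by ring

/-- Telescoping of `1 / √(l + 1) ≤ 2 (√(l + 1) - √l)`. -/
theorem sum_Icc_one_div_sqrt_le (l : ℕ) : ∑ k ∈ Finset.Icc 1 l, 1 / √(k : ℝ) ≤ 2 * √(l : ℝ) := by
  induction l with
  | zero => simp
  | succ l ih =>
    rw [Finset.sum_Icc_succ_top (by omega)]
    have h1 : 0 < √((l + 1 : ℕ) : ℝ) := by positivity
    have h2 : √((l + 1 : ℕ) : ℝ) ^ 2 = l + 1 := by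
      rw [Real.sq_sqrt (by positivity)]
      push_cast
      rfl
    have h3 : √(l : ℝ) ^ 2 = l := Real.sq_sqrt (by positivity)
    have h4 : 1 / √((l + 1 : ℕ) : ℝ) ≤ 2 * √((l + 1 : ℕ) : ℝ) - 2 * √(l : ℝ) := by
      rw [div_le_iff₀ h1]
      nlinarith [sq_nonneg (√((l + 1 : ℕ) : ℝ) - √(l : ℝ))]
    linarith

/-- By symmetry twice the triangle `k ≤ l` suffices. There the sum over `k` of `k ^ (-1/2)` cancels
the factor `l ^ (-1/2)`, so each `l` contributes at most `2 C / l`, and the harmonic sum gives the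
logarithm. -/
theorem sum_sum_Icc_le_of_abs_le {c : ℕ → ℕ → ℝ} (hsymm : ∀ k l, c k l = c l k) {C : ℝ} (hC : 0 ≤ C)
    (hc : ∀ k l, k ≤ l → c k l ≤ C * (√k / √l)) (N : ℕ) :
    ∑ k ∈ Finset.Icc 1 N, ∑ l ∈ Finset.Icc 1 N, (1 / (k : ℝ)) * ((1 / (l : ℝ)) * c k l) ≤
      4 * C * (1 + Real.log N) := by
  set a : ℕ → ℕ → ℝ := fun k l =>
    if k ≤ l then (1 / (k : ℝ)) * ((1 / (l : ℝ)) * (C * (√k / √l))) else 0 with ha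
  have ha0 : ∀ k l, 0 ≤ a k l := fun k l => by
    simp only [ha]
    split_ifs
    · positivity
    · rfl
  have hle : ∀ k l : ℕ, k ≤ l → (1 / (k : ℝ)) * ((1 / (l : ℝ)) * c k l) ≤ a k l := fun k l h => by
    simp only [ha, h, if_true]
    gcongr
    exact hc k l h
  have hca : ∀ k l : ℕ, (1 / (k : ℝ)) * ((1 / (l : ℝ)) * c k l) ≤ a k l + a l k := fun k l => by
    rcases le_total k l with h | h
    · exact (hle k l h).trans (le_add_of_nonneg_right (ha0 _ _))
    · rw [hsymm, mul_left_comm]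
      exact (hle l k h).trans (le_add_of_nonneg_left (ha0 _ _))
  have hcol : ∀ l ∈ Finset.Icc 1 N, ∑ k ∈ Finset.Icc 1 N, a k l ≤ 2 * C * (1 / (l : ℝ)) := by
    intro l hl
    rw [Finset.mem_Icc] at hl
    have hl0 : (0 : ℝ) < l := by exact_mod_cast hl.1
    have hs : 0 < √(l : ℝ) := Real.sqrt_pos.2 hl0
    calc ∑ k ∈ Finset.Icc 1 N, a k l
        = ∑ k ∈ Finset.Icc 1 l, a k l := by
          refine (Finset.sum_subset (Finset.Icc_subset_Icc_right hl.2) fun k hk hk' => ?_).symm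
          simp only [Finset.mem_Icc] at hk hk'
          simp only [ha]
          rw [if_neg (by omega)]
      _ = ∑ k ∈ Finset.Icc 1 l, C * (1 / (l : ℝ)) * (1 / √l) * (1 / √k) := by
          refine Finset.sum_congr rfl fun k hk => ?_
          rw [Finset.mem_Icc] at hk
          have hk0 : (0 : ℝ) < k := by exact_mod_cast hk.1
          have hsk : 0 < √(k : ℝ) := Real.sqrt_pos.2 hk0
          simp only [ha, hk.2, if_true]
          field_simp
          rw [Real.sq_sqrt hk0.le, mul_comm]
      _ = C * (1 / (l : ℝ)) * (1 / √l) * ∑ k ∈ Finset.Icc 1 l, 1 / √(k : ℝ) :=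
          (Finset.mul_sum _ _ _).symm
      _ ≤ C * (1 / (l : ℝ)) * (1 / √l) * (2 * √l) := by
          gcongr
          exact sum_Icc_one_div_sqrt_le l
      _ = 2 * C * (1 / (l : ℝ)) := by field_simp
  have htot : ∑ l ∈ Finset.Icc 1 N, ∑ k ∈ Finset.Icc 1 N, a k l ≤ 2 * C * (1 + Real.log N) := by
    refine (Finset.sum_le_sum hcol).trans ?_
    rw [← Finset.mul_sum]
    gcongr
    exact sum_Icc_one_div_le N
  calc _ ≤ ∑ k ∈ Finset.Icc 1 N, ∑ l ∈ Finset.Icc 1 N, (a k l + a l k) :=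
        Finset.sum_le_sum fun k _ => Finset.sum_le_sum fun l _ => hca k l
    _ = 2 * ∑ l ∈ Finset.Icc 1 N, ∑ k ∈ Finset.Icc 1 N, a k l := by
        simp only [Finset.sum_add_distrib]
        rw [Finset.sum_comm (f := fun k l => a k l), two_mul]
    _ ≤ _ := by linarith

theorem variance_logAverage_comp_normalizedSum_le (hindep : iIndepFun Z P)
    (hident : ∀ i, IdentDistrib (Z i) (Z 0) P P) (hsq : MemLp (Z 0) 2 P)
    (hmean : ∫ ω, Z 0 ω ∂P = 0) (hvar : ∫ ω, Z 0 ω ^ 2 ∂P = 1) (hf : IsUnitLipschitz f K) (N : ℕ) :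
    Var[fun ω => logAverage (fun n => f (normalizedSum Z n ω)) N; P] ≤
      (1 / Real.log N) ^ 2 * (8 * K * (1 + Real.log N)) := by
  have hma : ∀ i, AEMeasurable (Z i) P := fun i => (hident i).aemeasurable_fst
  simp only [logAverage]
  rw [variance_const_mul]
  gcongr
  have hsum : (fun ω => ∑ n ∈ Finset.Icc 1 N, (1 / (n : ℝ)) * f (normalizedSum Z n ω)) =
      ∑ n ∈ Finset.Icc 1 N, fun ω => (1 / (n : ℝ)) * f (normalizedSum Z n ω) := by
    ext ω
    simp
  rw [hsum, variance_sum' fun n _ => (hf.memLp_comp (aemeasurable_normalizedSum hma n)).const_mul _]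
  have hle := sum_sum_Icc_le_of_abs_le (C := 2 * K)
    (c := fun k l => cov[fun ω => f (normalizedSum Z k ω), fun ω => f (normalizedSum Z l ω); P])
    (fun k l => covariance_comm _ _) (mul_nonneg zero_le_two hf.lipschitz_const_nonneg)
    (fun k l hkl => ((le_abs_self _).trans (abs_covariance_comp_normalizedSum_le hindep hident hsq
      hmean hvar hf hkl)).trans (le_of_eq (by ring))) N
  rw [show 4 * (2 * K) = 8 * K by ring] at hle
  refine le_trans (le_of_eq ?_) hle
  refine Finset.sum_congr rfl fun k _ => Finset.sum_congr rfl fun l _ => ?_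
  rw [covariance_const_mul_left, covariance_const_mul_right]

theorem tendsto_integral_comp_normalizedSum (hindep : iIndepFun Z P)
    (hident : ∀ i, IdentDistrib (Z i) (Z 0) P P)
    (hmean : ∫ ω, Z 0 ω ∂P = 0) (hvar : ∫ ω, Z 0 ω ^ 2 ∂P = 1) (hf : IsUnitLipschitz f K) :
    Tendsto (fun n => ∫ ω, f (normalizedSum Z n ω) ∂P) atTop
      (𝓝 (∫ t, f t ∂(gaussianReal 0 1))) := by
  have hclt := tendstoInDistribution_inv_sqrt_mul_sum (Y := id) HasLaw.id hmean hvar hindep hident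
  have h := ProbabilityMeasure.tendsto_iff_forall_integral_tendsto.1 hclt.tendsto
    (.ofNormedAddCommGroup f hf.continuous 1 hf.abs_le_one)
  simp only [BoundedContinuousFunction.coe_ofNormedAddCommGroup, ProbabilityMeasure.coe_mk,
    Measure.map_id] at h
  refine h.congr fun n => ?_
  exact integral_map (hclt.forall_aemeasurable n) hf.continuous.aestronglyMeasurable

/-- The squared deviations have summable expectations, so almost surely they are summable and tend
to zero. -/
theorem ae_tendsto_sub_integral_of_summable_variance {A : ℕ → Ω → ℝ} (hA : ∀ j, MemLp (A j) 2 P)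
    (hsum : Summable fun j => Var[A j; P]) :
    ∀ᵐ ω ∂P, Tendsto (fun j => A j ω - ∫ ω', A j ω' ∂P) atTop (𝓝 0) := by
  have hsum' : Summable fun j => ∫ ω, (A j ω - ∫ ω', A j ω' ∂P) ^ 2 ∂P :=
    hsum.congr fun j => variance_eq_integral (hA j).aemeasurable
  have hint : ∀ j, Integrable (fun ω => (A j ω - ∫ ω', A j ω' ∂P) ^ 2) P := fun j =>
    ((hA j).sub (memLp_const (∫ ω', A j ω' ∂P))).integrable_sq
  filter_upwards [ae_summable_of_summable_integral hint (fun j ω => sq_nonneg _) hsum'] with ω hω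
  have h := hω.tendsto_atTop_zero.sqrt
  simp only [Real.sqrt_zero, Real.sqrt_sq_eq_abs] at h
  exact (tendsto_zero_iff_abs_tendsto_zero _).2 h

theorem variance_logAverage_comp_normalizedSum_two_pow_sq_le (hindep : iIndepFun Z P)
    (hident : ∀ i, IdentDistrib (Z i) (Z 0) P P) (hsq : MemLp (Z 0) 2 P)
    (hmean : ∫ ω, Z 0 ω ∂P = 0) (hvar : ∫ ω, Z 0 ω ^ 2 ∂P = 1) (hf : IsUnitLipschitz f K) (j : ℕ) :
    Var[fun ω => logAverage (fun n => f (normalizedSum Z n ω)) (2 ^ (j ^ 2)); P] ≤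
      8 * K / Real.log 2 * (1 / Real.log 2 + 1) * (1 / (j : ℝ) ^ 2) := by
  have hlog2 : 0 < Real.log 2 := Real.log_pos (by norm_num)
  have hK := hf.lipschitz_const_nonneg
  refine (variance_logAverage_comp_normalizedSum_le hindep hident hsq hmean hvar hf _).trans ?_
  rw [log_two_pow_sq]
  rcases Nat.eq_zero_or_pos j with rfl | hj
  -- At `j = 0` both sides vanish, by division by zero.
  · simp
  · have hj1 : (1 : ℝ) ≤ (j : ℝ) ^ 2 := one_le_pow₀ (by exact_mod_cast hj)
    calc (1 / ((j : ℝ) ^ 2 * Real.log 2)) ^ 2 * (8 * K * (1 + (j : ℝ) ^ 2 * Real.log 2))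
        ≤ (1 / ((j : ℝ) ^ 2 * Real.log 2)) ^ 2 *
            (8 * K * ((j : ℝ) ^ 2 + (j : ℝ) ^ 2 * Real.log 2)) := by gcongr
      _ = _ := by field_simp

theorem memLp_logAverage_comp_normalizedSum (hm : ∀ i, AEMeasurable (Z i) P)
    (hf : IsUnitLipschitz f K) (N : ℕ) :
    MemLp (fun ω => logAverage (fun n => f (normalizedSum Z n ω)) N) 2 P := by
  have h : MemLp (fun ω => ∑ n ∈ Finset.Icc 1 N, (1 / (n : ℝ)) * f (normalizedSum Z n ω)) 2 P :=
    memLp_finsetSum _ fun n _ =>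
      (hf.memLp_comp (aemeasurable_normalizedSum hm n)).const_mul (1 / (n : ℝ))
  exact h.const_mul (1 / Real.log N)

theorem tendsto_integral_logAverage_comp_normalizedSum (hindep : iIndepFun Z P)
    (hident : ∀ i, IdentDistrib (Z i) (Z 0) P P)
    (hmean : ∫ ω, Z 0 ω ∂P = 0) (hvar : ∫ ω, Z 0 ω ^ 2 ∂P = 1) (hf : IsUnitLipschitz f K) :
    Tendsto (fun N => ∫ ω, logAverage (fun n => f (normalizedSum Z n ω)) N ∂P) atTop
      (𝓝 (∫ t, f t ∂(gaussianReal 0 1))) := by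
  have hint : ∀ n, Integrable (fun ω => f (normalizedSum Z n ω)) P := fun n =>
    hf.integrable_comp (aemeasurable_normalizedSum (fun i => (hident i).aemeasurable_fst) n)
  refine (tendsto_logAverage_of_tendsto
    (tendsto_integral_comp_normalizedSum hindep hident hmean hvar hf)).congr fun N => ?_
  simp only [logAverage]
  rw [integral_const_mul, integral_finsetSum _ fun n _ => (hint n).const_mul _]
  simp only [integral_const_mul]

/-- The almost sure central limit theorem, tested on a single function. -/
theorem ae_tendsto_logAverage_comp_normalizedSum (hindep : iIndepFun Z P)
    (hident : ∀ i, IdentDistrib (Z i) (Z 0) P P) (hsq : MemLp (Z 0) 2 P)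
    (hmean : ∫ ω, Z 0 ω ∂P = 0) (hvar : ∫ ω, Z 0 ω ^ 2 ∂P = 1) (hf : IsUnitLipschitz f K) :
    ∀ᵐ ω ∂P, Tendsto (logAverage fun n => f (normalizedSum Z n ω)) atTop
      (𝓝 (∫ t, f t ∂(gaussianReal 0 1))) := by
  have hsum := Summable.of_nonneg_of_le (fun j => variance_nonneg _ _)
    (variance_logAverage_comp_normalizedSum_two_pow_sq_le hindep hident hsq hmean hvar hf)
    ((Real.summable_one_div_nat_pow.2 one_lt_two).mul_left _)
  have hpow : Tendsto (fun j : ℕ => 2 ^ (j ^ 2)) atTop atTop :=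
    (tendsto_pow_atTop_atTop_of_one_lt one_lt_two).comp (tendsto_pow_atTop two_ne_zero)
  have hlim := (tendsto_integral_logAverage_comp_normalizedSum hindep hident hmean hvar hf).comp hpow
  filter_upwards [ae_tendsto_sub_integral_of_summable_variance
    (fun j => memLp_logAverage_comp_normalizedSum (fun i => (hident i).aemeasurable_fst) hf _)
    hsum] with ω hω
  refine tendsto_logAverage_of_tendsto_subseq (fun n => hf.nonneg _) ?_
  have := hω.add hlim
  rw [zero_add] at this
  exact this.congr fun j => sub_add_cancel _ _

end

/-! ### Linearization of the logarithm of the product -/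

/-- The bounds `1 - 1 / x ≤ log x ≤ x - 1` differ by `(x - 1) ^ 2 / x`, and `1 / x ≤ 2`. -/
theorem abs_log_sub_sub_one_le {x : ℝ} (hx : 1 / 2 ≤ x) :
    |Real.log x - (x - 1)| ≤ 2 * (x - 1) ^ 2 := by
  have h0 : 0 < x := by linarith
  have h1 := Real.log_le_sub_one_of_pos h0
  have h2 := Real.one_sub_inv_le_log_of_pos h0
  have h3 : x - 1 - (1 - x⁻¹) ≤ 2 * (x - 1) ^ 2 := by
    have : x - 1 - (1 - x⁻¹) = (x - 1) ^ 2 * x⁻¹ := by field_simp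
    rw [this, mul_comm 2]
    gcongr
    rw [inv_le_comm₀ h0 two_pos]
    linarith
  rw [abs_of_nonpos (by linarith)]
  linarith

/-- Up to the factor `(n + 1) / n`, this is the difference of two consecutive averages. -/
theorem tendsto_div_zero_of_tendsto_sum_div {x : ℕ → ℝ} {μ : ℝ}
    (h : Tendsto (fun n : ℕ => (∑ i ∈ Finset.range n, x i) / n) atTop (𝓝 μ)) :
    Tendsto (fun n : ℕ => x n / n) atTop (𝓝 0) := by
  have h1 := (tendsto_add_atTop_iff_nat 1).2 h
  have hr : Tendsto (fun n : ℕ => 1 + 1 / (n : ℝ)) atTop (𝓝 (1 + 0)) :=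
    tendsto_const_nhds.add tendsto_one_div_atTop_nhds_zero_nat
  have h2 := (h1.mul hr).sub h
  simp only [add_zero, mul_one, sub_self] at h2
  refine h2.congr' ?_
  filter_upwards [eventually_gt_atTop 0] with n hn
  have : (0 : ℝ) < n := by exact_mod_cast hn
  rw [Finset.sum_range_succ]
  push_cast
  field_simp
  ring

/-- Late indices satisfy `x k ≤ ε k ≤ ε n`; the finitely many early ones are bounded by a constant,
which `ε n` eventually exceeds. -/
theorem eventually_forall_lt_le_mul {x : ℕ → ℝ} (h : Tendsto (fun n : ℕ => x n / n) atTop (𝓝 0))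
    {ε : ℝ} (hε : 0 < ε) : ∀ᶠ n : ℕ in atTop, ∀ k < n, x k ≤ ε * n := by
  obtain ⟨K, hK⟩ := eventually_atTop.1 ((h.eventually (gt_mem_nhds hε)).and (eventually_gt_atTop 0))
  filter_upwards [(tendsto_natCast_atTop_atTop.const_mul_atTop hε).eventually_ge_atTop
    (∑ i ∈ Finset.range K, |x i|)] with n hn k hk
  rcases lt_or_ge k K with h1 | h1
  · refine (le_abs_self _).trans (le_trans ?_ hn)
    exact Finset.single_le_sum (f := fun i => |x i|) (fun i _ => abs_nonneg _)
      (Finset.mem_range.2 h1)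
  · obtain ⟨h2, h3⟩ := hK k h1
    have hk0 : (0 : ℝ) < k := by exact_mod_cast h3
    rw [div_lt_iff₀ hk0] at h2
    refine h2.le.trans ?_
    gcongr

section

variable {Ω : Type*} {X : ℕ → Ω → ℝ} {μ σ γ : ℝ} {ω : Ω} {n : ℕ}

/-- The logarithm of the normalized product, written as a sum. -/
noncomputable def logNormalizedProduct (X : ℕ → Ω → ℝ) (μ γ : ℝ) (n : ℕ) (ω : Ω) : ℝ :=
  (1 / (γ * √n)) * ∑ k ∈ Finset.range n, Real.log (leaveOneOutSum X n k ω / (((n : ℝ) - 1) * μ))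

theorem eventually_half_le_leaveOneOutSum_div (hμ : 0 < μ)
    (h : Tendsto (fun n : ℕ => (∑ i ∈ Finset.range n, X i ω) / n) atTop (𝓝 μ)) :
    ∀ᶠ n in atTop, ∀ k < n, 1 / 2 ≤ leaveOneOutSum X n k ω / (((n : ℝ) - 1) * μ) := by
  have hx := tendsto_div_zero_of_tendsto_sum_div h
  -- The full sum exceeds `3 μ n / 4` and the omitted term is at most `μ n / 4`, leaving at least `μ
  -- n / 2`.
  filter_upwards [eventually_forall_lt_le_mul hx (show 0 < μ / 4 by positivity),
    h.eventually (lt_mem_nhds (show 3 / 4 * μ < μ by linarith)), eventually_ge_atTop 2]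
    with n h1 h2 h3 k hk
  have hn : (2 : ℝ) ≤ n := by exact_mod_cast h3
  have h4 := h1 k hk
  rw [lt_div_iff₀ (by linarith)] at h2
  rw [leaveOneOutSum, le_div_iff₀ (mul_pos (by linarith) hμ)]
  linarith

theorem normalizedProduct_eq_exp
    (h : ∀ k < n, 1 / 2 ≤ leaveOneOutSum X n k ω / (((n : ℝ) - 1) * μ)) :
    normalizedProduct X μ γ n ω = Real.exp (logNormalizedProduct X μ γ n ω) := by
  have hpos : ∀ k ∈ Finset.range n, 0 < leaveOneOutSum X n k ω / (((n : ℝ) - 1) * μ) :=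
    fun k hk => one_half_pos.trans_le (h k (Finset.mem_range.1 hk))
  have hprod : (∏ k ∈ Finset.range n, leaveOneOutSum X n k ω) / (((n : ℝ) - 1) ^ n * μ ^ n) =
      ∏ k ∈ Finset.range n, leaveOneOutSum X n k ω / (((n : ℝ) - 1) * μ) := by
    rw [Finset.prod_div_distrib, Finset.prod_const, Finset.card_range, mul_pow]
  rw [normalizedProduct, hprod, Real.rpow_def_of_pos (Finset.prod_pos hpos),
    Real.log_prod fun k hk => (hpos k hk).ne', logNormalizedProduct, mul_comm]

/-- The sum of the squared deviations of the normalized leave-one-out sums, in terms of the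
standardized variables. -/
noncomputable def sumSqDeviation (Z : ℕ → Ω → ℝ) (γ : ℝ) (n : ℕ) (ω : Ω) : ℝ :=
  ∑ k ∈ Finset.range n, (γ / ((n : ℝ) - 1) * ∑ i ∈ (Finset.range n).erase k, Z i ω) ^ 2

theorem sumSqDeviation_nonneg (Z : ℕ → Ω → ℝ) (γ : ℝ) (n : ℕ) (ω : Ω) :
    0 ≤ sumSqDeviation Z γ n ω := Finset.sum_nonneg fun _ _ => sq_nonneg _

theorem leaveOneOutSum_div_sub_one (hμ : 0 < μ) (hσ : 0 < σ) (hn : 2 ≤ n) {k : ℕ} (hk : k < n) :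
    leaveOneOutSum X n k ω / (((n : ℝ) - 1) * μ) - 1 =
      σ / μ / ((n : ℝ) - 1) * ∑ i ∈ (Finset.range n).erase k, (X i ω - μ) / σ := by
  have hn1 : (0 : ℝ) < (n : ℝ) - 1 := by
    have : (2 : ℝ) ≤ n := by exact_mod_cast hn
    linarith
  have hk' := Finset.mem_range.2 hk
  rw [← Finset.sum_div, Finset.sum_sub_distrib, Finset.sum_const, Finset.card_erase_of_mem hk',
    Finset.card_range, nsmul_eq_mul, Nat.cast_sub (by omega), Nat.cast_one, leaveOneOutSum,
    ← Finset.sum_erase_add _ _ hk', add_sub_cancel_right]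
  field_simp

/-- The `n` leave-one-out sums add up to `n - 1` times the full sum, so the factor `n - 1` cancels
and the linear part has no error term. -/
theorem normalizedSum_eq_sum_leaveOneOutSum (hμ : 0 < μ) (hσ : 0 < σ) (hn : 2 ≤ n) :
    normalizedSum (fun i ω => (X i ω - μ) / σ) n ω =
      (1 / (σ / μ * √n)) *
        ∑ k ∈ Finset.range n, (leaveOneOutSum X n k ω / (((n : ℝ) - 1) * μ) - 1) := by
  have hn2 : (2 : ℝ) ≤ n := by exact_mod_cast hn
  have hn1 : (0 : ℝ) < (n : ℝ) - 1 := by linarith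
  have hs : 0 < √(n : ℝ) := Real.sqrt_pos.2 (by linarith)
  simp only [normalizedSum, leaveOneOutSum, ← Finset.sum_div, Finset.sum_sub_distrib,
    Finset.sum_const, Finset.card_range, nsmul_eq_mul]
  field_simp

theorem abs_logNormalizedProduct_sub_normalizedSum_le (hμ : 0 < μ) (hσ : 0 < σ) (hn : 2 ≤ n)
    (h : ∀ k < n, 1 / 2 ≤ leaveOneOutSum X n k ω / (((n : ℝ) - 1) * μ)) :
    |logNormalizedProduct X μ (σ / μ) n ω - normalizedSum (fun i ω => (X i ω - μ) / σ) n ω| ≤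
      (1 / (σ / μ * √n)) * (2 * sumSqDeviation (fun i ω => (X i ω - μ) / σ) (σ / μ) n ω) := by
  have h0 : 0 ≤ 1 / (σ / μ * √(n : ℝ)) := by positivity
  rw [normalizedSum_eq_sum_leaveOneOutSum hμ hσ hn, logNormalizedProduct, ← mul_sub, abs_mul,
    abs_of_nonneg h0, ← Finset.sum_sub_distrib]
  refine mul_le_mul_of_nonneg_left ((Finset.abs_sum_le_sum_abs _ _).trans ?_) h0
  rw [sumSqDeviation, Finset.mul_sum]
  refine Finset.sum_le_sum fun k hk => ?_
  have hk' := Finset.mem_range.1 hk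
  rw [← leaveOneOutSum_div_sub_one hμ hσ hn hk']
  exact abs_log_sub_sub_one_le (h k hk')

theorem tendsto_logAverage_ramp_logNormalizedProduct (hμ : 0 < μ) (hσ : 0 < σ)
    (hhalf : ∀ᶠ n in atTop, ∀ k < n, 1 / 2 ≤ leaveOneOutSum X n k ω / (((n : ℝ) - 1) * μ))
    (hsum : Summable fun n : ℕ => (1 / (n : ℝ)) * (1 / √(n : ℝ)) *
      sumSqDeviation (fun i ω => (X i ω - μ) / σ) (σ / μ) n ω)
    {q m l : ℝ} (hm : 0 ≤ m)
    (hlim : Tendsto (logAverage fun n => ramp q m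
      (normalizedSum (fun i ω => (X i ω - μ) / σ) n ω)) atTop (𝓝 l)) :
    Tendsto (logAverage fun n => ramp q m (logNormalizedProduct X μ (σ / μ) n ω)) atTop (𝓝 l) := by
  set W : ℕ → ℝ := fun n => normalizedSum (fun i ω => (X i ω - μ) / σ) n ω with hW
  set Y : ℕ → ℝ := fun n => logNormalizedProduct X μ (σ / μ) n ω with hY
  have hdiff : Tendsto (logAverage fun n => ramp q m (Y n) - ramp q m (W n)) atTop (𝓝 0) := by
    refine tendsto_logAverage_zero_of_summable ?_
    refine Summable.of_norm_bounded_eventually_nat (hsum.mul_left (m * (2 / (σ / μ)))) ?_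
    filter_upwards [hhalf, eventually_ge_atTop 2] with n h1 h2
    rw [Real.norm_of_nonneg (by positivity)]
    calc (1 / (n : ℝ)) * |ramp q m (Y n) - ramp q m (W n)|
        ≤ (1 / (n : ℝ)) * (m * ((1 / (σ / μ * √n)) *
            (2 * sumSqDeviation (fun i ω => (X i ω - μ) / σ) (σ / μ) n ω))) := by
          gcongr
          refine (abs_ramp_sub_le hm _ _).trans ?_
          gcongr
          exact abs_logNormalizedProduct_sub_normalizedSum_le hμ hσ h2 h1
      _ = _ := by
          rw [← one_div_mul_one_div]
          ring
  have := hdiff.add hlim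
  rw [zero_add] at this
  exact this.congr fun N => by rw [logAverage_sub]; simp only [hW]; ring

variable [MeasurableSpace Ω] {P : Measure Ω} {Z : ℕ → Ω → ℝ}

theorem integrable_sumSqDeviation (hm : ∀ i, MemLp (Z i) 2 P) (γ : ℝ) (n : ℕ) :
    Integrable (sumSqDeviation Z γ n) P :=
  integrable_finsetSum _ fun _ _ =>
    ((memLp_finsetSum _ fun i _ => hm i).const_mul (γ / ((n : ℝ) - 1))).integrable_sq

variable [IsProbabilityMeasure P]

/-- For `n ≥ 2` each of the `n` squares has expectation `γ ^ 2 / (n - 1)`, and `n / (n - 1) ≤ 2`. -/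
theorem integral_sumSqDeviation_le (hindep : iIndepFun Z P)
    (hident : ∀ i, IdentDistrib (Z i) (Z 0) P P) (hsq : MemLp (Z 0) 2 P)
    (hmean : ∫ ω, Z 0 ω ∂P = 0) (hvar : ∫ ω, Z 0 ω ^ 2 ∂P = 1) (γ : ℝ) (n : ℕ) :
    ∫ ω, sumSqDeviation Z γ n ω ∂P ≤ 2 * γ ^ 2 := by
  have hm : ∀ i, MemLp (Z i) 2 P := fun i => (hident i).memLp_iff.2 hsq
  simp only [sumSqDeviation]
  rw [integral_finsetSum _ fun k _ =>
    ((memLp_finsetSum _ fun i _ => hm i).const_mul (γ / ((n : ℝ) - 1))).integrable_sq]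
  simp only [mul_pow, integral_const_mul, integral_sq_sum_of_iIndepFun hindep hident hsq hmean, hvar]
  rw [Finset.sum_congr rfl fun k hk => by rw [Finset.card_erase_of_mem hk, Finset.card_range],
    Finset.sum_const, Finset.card_range, nsmul_eq_mul, mul_one]
  rcases Nat.lt_or_ge n 2 with hn | hn
  · interval_cases n <;> simp <;> positivity
  · have hn2 : (2 : ℝ) ≤ n := by exact_mod_cast hn
    have hn1 : (0 : ℝ) < (n : ℝ) - 1 := by linarith
    rw [Nat.cast_sub (by omega), Nat.cast_one]
    have : (n : ℝ) * ((γ / ((n : ℝ) - 1)) ^ 2 * ((n : ℝ) - 1)) = n / ((n : ℝ) - 1) * γ ^ 2 := by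
      field_simp
    rw [this]
    gcongr
    rw [div_le_iff₀ hn1]
    linarith

theorem summable_one_div_mul_one_div_sqrt :
    Summable fun n : ℕ => (1 / (n : ℝ)) * (1 / √(n : ℝ)) := by
  refine (Real.summable_one_div_nat_rpow (p := 3 / 2).2 (by norm_num)).congr fun n => ?_
  rcases Nat.eq_zero_or_pos n with rfl | hn
  · simp
  · have : (0 : ℝ) < n := by exact_mod_cast hn
    rw [one_div_mul_one_div, Real.sqrt_eq_rpow, show (3 / 2 : ℝ) = 1 + 1 / 2 by norm_num,
      Real.rpow_add this, Real.rpow_one]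

/-- The expectations are dominated by a multiple of `n ^ (-3/2)`. -/
theorem ae_summable_sumSqDeviation (hindep : iIndepFun Z P)
    (hident : ∀ i, IdentDistrib (Z i) (Z 0) P P) (hsq : MemLp (Z 0) 2 P)
    (hmean : ∫ ω, Z 0 ω ∂P = 0) (hvar : ∫ ω, Z 0 ω ^ 2 ∂P = 1) (γ : ℝ) :
    ∀ᵐ ω ∂P, Summable fun n : ℕ => (1 / (n : ℝ)) * (1 / √(n : ℝ)) * sumSqDeviation Z γ n ω := by
  have hm : ∀ i, MemLp (Z i) 2 P := fun i => (hident i).memLp_iff.2 hsq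
  refine ae_summable_of_summable_integral
    (fun n => (integrable_sumSqDeviation hm γ n).const_mul _)
    (fun n ω => mul_nonneg (by positivity) (sumSqDeviation_nonneg _ _ _ _)) ?_
  simp only [integral_const_mul]
  refine Summable.of_nonneg_of_le
    (fun n => mul_nonneg (by positivity) (integral_nonneg fun ω => sumSqDeviation_nonneg _ _ _ _))
    (fun n => ?_) (summable_one_div_mul_one_div_sqrt.mul_right (2 * γ ^ 2))
  gcongr
  exact integral_sumSqDeviation_le hindep hident hsq hmean hvar γ n

end

/-! ### The limit theorem for the product -/

theorem isUnitLipschitz_ramp (q : ℝ) {m : ℝ} (hm : 0 ≤ m) : IsUnitLipschitz (ramp q m) m where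
  nonneg := ramp_nonneg q m
  le_one := ramp_le_one q m
  abs_sub_le := abs_ramp_sub_le hm
  continuous := continuous_ramp q m

theorem theorem2 {Ω : Type*} [MeasurableSpace Ω] (P : Measure Ω) [IsProbabilityMeasure P]
    (X : ℕ → Ω → ℝ)
    (hindep : iIndepFun X P)
    (hident : ∀ i, IdentDistrib (X i) (X 0) P P)
    (hpos : ∀ i, ∀ᵐ ω ∂P, 0 < X i ω)
    (hsq : MemLp (X 0) 2 P)
    (μ σ γ : ℝ)
    (hμ : ∫ ω, X 0 ω ∂P = μ)
    (hvar : variance (X 0) P = σ ^ 2)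
    (hσ : 0 < σ)
    (hγ : γ = σ / μ) :
    ∀ᵐ ω ∂P, ∀ x : ℝ,
      Tendsto
        (fun N : ℕ => (1 / Real.log (N : ℝ)) *
          ∑ n ∈ Finset.Icc 1 N,
            (1 / (n : ℝ)) *
              (Set.Iic x).indicator (fun _ => (1 : ℝ)) (normalizedProduct X μ γ n ω))
        atTop (𝓝 (cdfExpNormal x)) := by
  subst hγ
  have hint : Integrable (X 0) P := hsq.integrable (by norm_num)
  have hμ0 : 0 < μ := by
    rw [← hμ, integral_pos_iff_support_of_nonneg_ae ((hpos 0).mono fun ω h => h.le) hint]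
    have hfull : ∀ᵐ ω ∂P, ω ∈ Function.support (X 0) := (hpos 0).mono fun ω h => h.ne'
    rw [measure_eq_measure_of_null_sdiff (Set.subset_univ _) (by
      rw [← Set.compl_eq_univ_sdiff]; exact hfull), measure_univ]
    exact one_pos
  set Z : ℕ → Ω → ℝ := fun i ω => (X i ω - μ) / σ with hZ
  have hmeas : Measurable fun x : ℝ => (x - μ) / σ := by fun_prop
  have hZindep : iIndepFun Z P := hindep.comp (fun _ x => (x - μ) / σ) fun _ => hmeas
  have hZident : ∀ i, IdentDistrib (Z i) (Z 0) P P := fun i => (hident i).comp hmeas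
  have hZsq : MemLp (Z 0) 2 P := by
    have h := (hsq.sub (memLp_const μ)).mul_const σ⁻¹
    simpa only [hZ, div_eq_mul_inv, Pi.sub_apply] using h
  have hZmean : ∫ ω, Z 0 ω ∂P = 0 := by
    simp only [hZ]
    rw [integral_div, integral_sub hint (integrable_const _), hμ]
    simp
  have hZvar : ∫ ω, Z 0 ω ^ 2 ∂P = 1 := by
    simp only [hZ, div_pow]
    rw [variance_eq_integral hsq.aemeasurable, hμ] at hvar
    rw [integral_div, hvar, div_self (by positivity)]
  have hslln := strong_law_ae_real X hint (fun i j hij => hindep.indepFun hij) hident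
  rw [hμ] at hslln
  -- Rational `q` and natural `m` form a countable family, so one null set serves every real `x`.
  have hclt : ∀ᵐ ω ∂P, ∀ (q : ℚ) (m : ℕ), Tendsto (logAverage fun n =>
      ramp q m (normalizedSum Z n ω)) atTop (𝓝 (∫ t, ramp q m t ∂(gaussianReal 0 1))) :=
    ae_all_iff.2 fun q => ae_all_iff.2 fun m => ae_tendsto_logAverage_comp_normalizedSum hZindep
      hZident hZsq hZmean hZvar (isUnitLipschitz_ramp q m.cast_nonneg)
  filter_upwards [hslln, hclt,
    ae_summable_sumSqDeviation hZindep hZident hZsq hZmean hZvar (σ / μ)] with ω h1 h2 h3 x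
  have hhalf := eventually_half_le_leaveOneOutSum_div hμ0 h1
  exact tendsto_logAverage_indicator_exp (hhalf.mono fun n hn => normalizedProduct_eq_exp hn)
    (fun q m => tendsto_logAverage_ramp_logNormalizedProduct hμ0 hσ hhalf h3 m.cast_nonneg (h2 q m)) x
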